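/- Let $p$ be a prime, let $k$ be a field of characteristic $p$, and let $G$ be a locally profinite group (a locally compact, Hausdorff, totally disconnected topological group) with center $Z(G)$. Suppose that $G$ contains an open pro-$p$ subgroup, and that $G$ contains no proper open centralisers, i.e. for every $x \in G$, if the centraliser $C_G(x)$ is open in $G$ then $C_G(x) = G$. Let $\mathrm{Mod}(G)$ be the category of smooth $k$-linear representations of $G$ (those in which every vector is fixed by an open subgroup of $G$), and let $\mathfrak{Z}(G)$ be the Bernstein center of $G$, i.e. the $k$-algebra of natural endomorphisms of the identity functor on $\mathrm{Mod}(G)$. Let $$\widehat{k[Z(G)]} := \varprojlim_{Z'} k[Z(G)/Z'],$$ where $Z'$ runs over the compact open subgroups of $Z(G)$. Let $\Phi : \widehat{k[Z(G)]} \to \mathfrak{Z}(G)$ be the natural $k$-algebra homomorphism: for $V \in \mathrm{Mod}(G)$, a compact open subgroup $H$ of $G$, and a vector $v \in V^H$, an element $x \in \widehat{k[Z(G)]}$ acts on $v$ through its component in $k[Z(G)/(Z(G)\cap H)]$, via the action of $Z(G)/(Z(G) \cap H)$ on $V^H$. Then $\Phi : \widehat{k[Z(G)]} \to \mathfrak{Z}(G)$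 is an isomorphism of $k$-algebras. -/

import Mathlib

open CategoryTheory

universe u v w

noncomputable section

/-! ### Topological groups -/

/-- The compact open subgroups of a topological group. -/
abbrev CompactOpenSubgroup (Z : Type*) [Group Z] [TopologicalSpace Z] :=
  {K : Subgroup Z // IsOpen (K : Set Z) ∧ IsCompact (K : Set Z)}

/-- A locally profinite group: a locally compact, Hausdorff, totally disconnected topological
group. -/
class IsLocallyProfinite (G : Type*) [Group G] [TopologicalSpace G] : Prop
    extends IsTopologicalGroup G, LocallyCompactSpace G, T2Space G, TotallyDisconnectedSpace G

/-- A pro-`p` group: a profinite group in which every open normal subgroup has index a power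
of `p`. -/
structure IsProP (p : ℕ) (H : Type*) [Group H] [TopologicalSpace H] : Prop
    extends IsTopologicalGroup H, CompactSpace H, T2Space H, TotallyDisconnectedSpace H where
  index_eq : ∀ N : Subgroup H, N.Normal → IsOpen (N : Set H) → ∃ n : ℕ, N.index = p ^ n

/-- `G` contains an open pro-`p` subgroup. -/
def IsLocallyProP (p : ℕ) (G : Type*) [Group G] [TopologicalSpace G] : Prop :=
  ∃ U : Subgroup G, IsOpen (U : Set G) ∧ IsProP p U

/-- The only open subgroup of `G` which is the centraliser of an element of `G` is `G` itself. -/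
def NoProperOpenCentralisers (G : Type*) [Group G] [TopologicalSpace G] : Prop :=
  ∀ x : G, IsOpen (Subgroup.centralizer {x} : Set G) → Subgroup.centralizer {x} = ⊤

/-- In a locally profinite group every open subgroup contains a compact open subgroup. -/
theorem IsLocallyProfinite.exists_compactOpenSubgroup_le {G : Type*} [Group G] [TopologicalSpace G]
    [IsLocallyProfinite G] (U : Subgroup G) (hU : IsOpen (U : Set G)) :
    ∃ H : CompactOpenSubgroup G, H.1 ≤ U := by
  obtain ⟨C, hC, h1C⟩ := exists_compact_mem_nhds (1 : G)
  obtain ⟨W, hW, h1W, hWC⟩ := (loc_compact_Haus_tot_disc_of_zero_dim (H := G)).mem_nhds_iff.1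
    (Filter.inter_mem h1C (hU.mem_nhds U.one_mem))
  have hWc : IsCompact W := hC.of_isClosed_subset hW.1 (hWC.trans Set.inter_subset_left)
  obtain ⟨T, hT, hWT⟩ := compact_open_separated_mul_right hWc hW.2 subset_rfl
  let S : Subgroup G :=
    { carrier := {g | ∀ x, x * g ∈ W ↔ x ∈ W}
      mul_mem' := fun {a b} ha hb x => by rw [← mul_assoc, hb, ha]
      one_mem' := fun x => by rw [mul_one]
      inv_mem' := fun {a} ha x => by rw [← ha, inv_mul_cancel_right] }
  have hSW : (S : Set G) ⊆ W := fun g hg => by simpa using (hg 1).2 h1W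
  have hSo : IsOpen (S : Set G) := by
    refine S.isOpen_of_mem_nhds (g := 1) (Filter.mem_of_superset
      (Filter.inter_mem hT (inv_mem_nhds_one G hT)) ?_)
    rintro g ⟨hg, hg'⟩ x
    refine ⟨fun hx => ?_, fun hx => hWT (Set.mul_mem_mul hx hg)⟩
    simpa using hWT (Set.mul_mem_mul hx hg')
  exact ⟨⟨S, hSo, hWc.of_isClosed_subset (S.isClosed_of_isOpen hSo) hSW⟩,
    fun g hg => (hWC (hSW hg)).2⟩

/-- The intersection of a compact open subgroup with the center, as a compact open subgroup of
the center. -/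
def CompactOpenSubgroup.centerInter {G : Type*} [Group G] [TopologicalSpace G]
    [IsLocallyProfinite G] (H : CompactOpenSubgroup G) :
    CompactOpenSubgroup (Subgroup.center G) :=
  ⟨H.1.subgroupOf (Subgroup.center G), H.2.1.preimage continuous_subtype_val, by
    have hc : IsClosed (Subgroup.center G : Set G) := by
      rw [← Subgroup.centralizer_univ]
      exact Set.isClosed_centralizer _
    exact hc.isClosedEmbedding_subtypeVal.isCompact_preimage H.2.2⟩

/-! ### The completed group algebra of an abelian group -/

section Completion

variable (k : Type u) (Z : Type v) [Field k] [Group Z] [IsMulCommutative Z] [TopologicalSpace Z]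

/-- The inverse limit of the group algebras `k[Z ⧸ K]`, where `K` runs over the compact open
subgroups of `Z`, along the maps induced by the projections `Z ⧸ K → Z ⧸ L` for `K ≤ L`. -/
def completedGroupAlgebra :
    Subalgebra k (∀ K : CompactOpenSubgroup Z, MonoidAlgebra k (Z ⧸ K.1)) where
  carrier := {x | ∀ (K L : CompactOpenSubgroup Z) (h : K.1 ≤ L.1),
    MonoidAlgebra.mapDomainAlgHom k k (QuotientGroup.map K.1 L.1 (MonoidHom.id Z) h) (x K) = x L}
  mul_mem' := fun hx hy K L h => by
    rw [Pi.mul_apply, Pi.mul_apply, map_mul, hx K L h, hy K L h]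
  add_mem' := fun hx hy K L h => by
    rw [Pi.add_apply, Pi.add_apply, map_add, hx K L h, hy K L h]
  algebraMap_mem' := fun r K L h => by
    rw [Pi.algebraMap_apply, Pi.algebraMap_apply, AlgHom.commutes]

variable {k Z} {V W : Type*} [AddCommGroup V] [Module k V] [AddCommGroup W] [Module k W]

/-- Every vector is fixed by some compact open subgroup. -/
def IsCompactOpenFixed (ρ : Representation k Z V) : Prop :=
  ∀ v : V, ∃ K : CompactOpenSubgroup Z,
    v ∈ Representation.invariants (ρ.comp K.1.subtype)

variable (ρ : Representation k Z V) (σ : Representation k Z W)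

/-- The action of `k[Z ⧸ K]` on the `K`-fixed vectors. -/
def fixedAction (K : CompactOpenSubgroup Z) :
    MonoidAlgebra k (Z ⧸ K.1) →ₐ[k]
      Module.End k (Representation.invariants (ρ.comp K.1.subtype)) :=
  (Representation.quotientToInvariants ρ K.1).asAlgebraHom

variable {ρ σ}

theorem fixedAction_map (f : V →ₗ[k] W) (hf : ∀ z v, f (ρ z v) = σ z (f v))
    (K L : CompactOpenSubgroup Z) (h : K.1 ≤ L.1)
    (a : MonoidAlgebra k (Z ⧸ K.1)) (v : V)
    (hv : v ∈ Representation.invariants (ρ.comp K.1.subtype))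
    (hw : f v ∈ Representation.invariants (σ.comp L.1.subtype)) :
    f (fixedAction ρ K a ⟨v, hv⟩ : V) = (fixedAction σ L
      (MonoidAlgebra.mapDomainAlgHom k k (QuotientGroup.map K.1 L.1 (MonoidHom.id Z) h) a)
        ⟨f v, hw⟩ : W) := by
  induction a using MonoidAlgebra.induction_linear with
  | zero => simp
  | add a b ha hb => simp only [map_add, LinearMap.add_apply, Submodule.coe_add, ha, hb]
  | single g r =>
    induction g using QuotientGroup.induction_on with
    | H z =>
      simp only [fixedAction, Representation.asAlgebraHom_single,
        MonoidAlgebra.mapDomainAlgHom_apply, MonoidAlgebra.mapDomain_single, LinearMap.smul_apply,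
        Submodule.coe_smul, map_smul]
      congr 1
      exact hf z v

/-- The action of an element of the completed group algebra on a vector `v`: the given family
acts through its component at any compact open subgroup which fixes `v`. -/
def completedActionFun (h : IsCompactOpenFixed ρ) (x : completedGroupAlgebra k Z) (v : V) : V :=
  (fixedAction ρ (h v).choose (x.1 (h v).choose) ⟨v, (h v).choose_spec⟩ : V)

theorem completedActionFun_map_eq [IsTopologicalGroup Z] (h : IsCompactOpenFixed ρ)
    (x : completedGroupAlgebra k Z) (f : V →ₗ[k] W) (hf : ∀ z v, f (ρ z v) = σ z (f v)) (v : V)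
    (L : CompactOpenSubgroup Z) (hw : f v ∈ Representation.invariants (σ.comp L.1.subtype)) :
    f (completedActionFun h x v) = (fixedAction σ L (x.1 L) ⟨f v, hw⟩ : W) := by
  have key : ∀ (K : CompactOpenSubgroup Z)
      (hv : v ∈ Representation.invariants (ρ.comp K.1.subtype)),
      f (fixedAction ρ K (x.1 K) ⟨v, hv⟩ : V) = (fixedAction σ L (x.1 L) ⟨f v, hw⟩ : W) := by
    intro K hv
    let M : CompactOpenSubgroup Z :=
      ⟨K.1 ⊓ L.1, K.2.1.inter L.2.1, K.2.2.inter_right (L.1.isClosed_of_isOpen L.2.1)⟩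
    have hvM : v ∈ Representation.invariants (ρ.comp M.1.subtype) :=
      fun g => hv ⟨g.1, g.2.1⟩
    have h1 := fixedAction_map (ρ := ρ) (σ := ρ) LinearMap.id (fun _ _ => rfl) M K inf_le_left
      (x.1 M) v hvM hv
    have h2 := fixedAction_map f hf M L inf_le_right (x.1 M) v hvM hw
    rw [x.2 M K inf_le_left] at h1
    rw [x.2 M L inf_le_right] at h2
    rw [← h2]
    exact congrArg f h1.symm
  exact key _ _

theorem completedActionFun_eq [IsTopologicalGroup Z] (h : IsCompactOpenFixed ρ)
    (x : completedGroupAlgebra k Z) (v : V) (L : CompactOpenSubgroup Z)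
    (hv : v ∈ Representation.invariants (ρ.comp L.1.subtype)) :
    completedActionFun h x v = (fixedAction ρ L (x.1 L) ⟨v, hv⟩ : V) :=
  completedActionFun_map_eq h x LinearMap.id (fun _ _ => rfl) v L hv

theorem completedActionFun_comm [IsTopologicalGroup Z] (h : IsCompactOpenFixed ρ)
    (h' : IsCompactOpenFixed σ) (x : completedGroupAlgebra k Z) (f : V →ₗ[k] W)
    (hf : ∀ z v, f (ρ z v) = σ z (f v)) (v : V) :
    f (completedActionFun h x v) = completedActionFun h' x (f v) :=
  completedActionFun_map_eq h x f hf v _ (h' (f v)).choose_spec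

section Action

variable [IsTopologicalGroup Z] (h : IsCompactOpenFixed ρ)

theorem completedActionFun_add (x : completedGroupAlgebra k Z) (v w : V) :
    completedActionFun h x (v + w) = completedActionFun h x v + completedActionFun h x w := by
  obtain ⟨K, hK⟩ := h v
  obtain ⟨L, hL⟩ := h w
  let M : CompactOpenSubgroup Z :=
    ⟨K.1 ⊓ L.1, K.2.1.inter L.2.1, K.2.2.inter_right (L.1.isClosed_of_isOpen L.2.1)⟩
  have hv : v ∈ Representation.invariants (ρ.comp M.1.subtype) := fun g => hK ⟨g.1, g.2.1⟩
  have hw : w ∈ Representation.invariants (ρ.comp M.1.subtype) := fun g => hL ⟨g.1, g.2.2⟩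
  rw [completedActionFun_eq h x v M hv, completedActionFun_eq h x w M hw,
    completedActionFun_eq h x (v + w) M (add_mem hv hw)]
  exact congrArg Subtype.val
    ((fixedAction ρ M (x.1 M)).map_add ⟨v, hv⟩ ⟨w, hw⟩)

theorem completedActionFun_smul (x : completedGroupAlgebra k Z) (r : k) (v : V) :
    completedActionFun h x (r • v) = r • completedActionFun h x v := by
  obtain ⟨K, hv⟩ := h v
  rw [completedActionFun_eq h x v K hv,
    completedActionFun_eq h x (r • v) K (Submodule.smul_mem _ r hv)]
  exact congrArg Subtype.val ((fixedAction ρ K (x.1 K)).map_smul r ⟨v, hv⟩)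

theorem completedActionFun_mul (x y : completedGroupAlgebra k Z) (v : V) :
    completedActionFun h (x * y) v = completedActionFun h x (completedActionFun h y v) := by
  obtain ⟨K, hv⟩ := h v
  rw [completedActionFun_eq h (x * y) v K hv, completedActionFun_eq h y v K hv,
    completedActionFun_eq h x _ K (Subtype.property _)]
  exact congrArg (fun T : Module.End k (Representation.invariants (ρ.comp K.1.subtype)) =>
    (T ⟨v, hv⟩ : V)) (map_mul (fixedAction ρ K) (x.1 K) (y.1 K))

/-- The action of a fixed element of the completed group algebra, as a linear map. -/
def completedActionLinear (x : completedGroupAlgebra k Z) : Module.End k V where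
  toFun := completedActionFun h x
  map_add' := completedActionFun_add h x
  map_smul' := completedActionFun_smul h x

/-- The action of the completed group algebra on a representation in which every vector is fixed
by some compact open subgroup. -/
def completedAction : completedGroupAlgebra k Z →ₐ[k] Module.End k V :=
  AlgHom.ofLinearMap
    { toFun := completedActionLinear h
      map_add' := fun x y => LinearMap.ext fun v =>
        congrArg (fun T : Module.End k (Representation.invariants
          (ρ.comp (h v).choose.1.subtype)) => (T ⟨v, (h v).choose_spec⟩ : V))
          (map_add (fixedAction ρ (h v).choose) (x.1 _) (y.1 _))
      map_smul' := fun r x => LinearMap.ext fun v =>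
        congrArg (fun T : Module.End k (Representation.invariants
          (ρ.comp (h v).choose.1.subtype)) => (T ⟨v, (h v).choose_spec⟩ : V))
          (map_smul (fixedAction ρ (h v).choose) r (x.1 _)) }
    (LinearMap.ext fun v =>
      congrArg (fun T : Module.End k (Representation.invariants
          (ρ.comp (h v).choose.1.subtype)) => (T ⟨v, (h v).choose_spec⟩ : V))
          (map_one (fixedAction ρ (h v).choose)))
    (fun x y => LinearMap.ext fun v => completedActionFun_mul h x y v)

end Action

end Completion

/-! ### Smooth representations and the Bernstein center -/

section Smooth

variable (k : Type u) (G : Type v) [Field k] [Group G] [TopologicalSpace G]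

/-- A representation is smooth if every vector is fixed by an open subgroup. -/
def isSmoothRep : ObjectProperty (Rep.{w} k G) := fun V =>
  ∀ v : V, ∃ U : Subgroup G, IsOpen (U : Set G) ∧ ∀ g ∈ U, V.ρ g v = v

/-- The category of smooth `k`-linear representations of `G`. -/
abbrev SmoothRep := (isSmoothRep.{u, v, w} k G).FullSubcategory

/-- The Bernstein center of `G`: the `k`-algebra of natural endomorphisms of the identity functor
of the category of smooth representations. -/
abbrev BernsteinCenter := CatCenter (SmoothRep.{u, v, w} k G)

variable {k G}

/-- The action of the center of `G` on a representation of `G`. -/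
abbrev centerRep (V : Rep.{w} k G) : Representation k (Subgroup.center G) V :=
  V.ρ.comp (Subgroup.center G).subtype

/-- A vector fixed by a compact open subgroup `H` of `G` is fixed by its intersection with the
center. -/
theorem mem_invariants_centerInter [IsLocallyProfinite G] {V : Rep.{w} k G} {v : V}
    (H : CompactOpenSubgroup G) (hv : ∀ g ∈ H.1, V.ρ g v = v) :
    v ∈ Representation.invariants ((centerRep V).comp H.centerInter.1.subtype) :=
  fun z => hv _ z.2

theorem SmoothRep.isCompactOpenFixed [IsLocallyProfinite G] (V : SmoothRep.{u, v, w} k G) :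
    IsCompactOpenFixed (centerRep V.obj) := fun v => by
  obtain ⟨U, hU, hv⟩ := V.property v
  obtain ⟨H, hH⟩ := IsLocallyProfinite.exists_compactOpenSubgroup_le U hU
  exact ⟨H.centerInter, mem_invariants_centerInter H fun g hg => hv g (hH hg)⟩

variable (k G)

/-- The natural map from the completed group algebra of the center of `G` to the Bernstein
center of `G`. -/
def bernsteinMap [IsLocallyProfinite G] :
    completedGroupAlgebra k (Subgroup.center G) →ₐ[k] BernsteinCenter.{u, v, w} k G :=
  AlgHom.ofLinearMap
    { toFun := fun x =>
        { app := fun V => ObjectProperty.homMk (Rep.ofHom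
            { toLinearMap := completedAction V.isCompactOpenFixed x
              isIntertwining' := fun g => LinearMap.ext fun v =>
                (completedActionFun_comm V.isCompactOpenFixed V.isCompactOpenFixed x (V.obj.ρ g)
                  (fun z v => by
                    have hz := Subgroup.mem_center_iff.1 z.2 g
                    change V.obj.ρ g (V.obj.ρ z.1 v) = V.obj.ρ z.1 (V.obj.ρ g v)
                    rw [← Module.End.mul_apply, ← map_mul, hz, map_mul, Module.End.mul_apply])
                  v).symm })
          naturality := fun V W f => by
            ext v
            exact (completedActionFun_comm V.isCompactOpenFixed W.isCompactOpenFixed x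
              f.hom.hom.toLinearMap (fun z v => Rep.hom_comm_apply f.hom z.1 v) v).symm }
      map_add' := fun x y => by
        ext V v
        exact congrArg (fun T : Module.End k V.obj => T v)
          (map_add (completedAction V.isCompactOpenFixed) x y)
      map_smul' := fun r x => by
        ext V v
        exact congrArg (fun T : Module.End k V.obj => T v)
          (map_smul (completedAction V.isCompactOpenFixed) r x) }
    (by
      ext V v
      exact congrArg (fun T : Module.End k V.obj => T v)
        (map_one (completedAction V.isCompactOpenFixed)))
    (fun x y => by
      ext V v
      exact congrArg (fun T : Module.End k V.obj => T v)
        (map_mul (completedAction V.isCompactOpenFixed) x y))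

/-- On the vectors fixed by a compact open subgroup `H` of `G`, an element of the completed group
algebra acts through its component in `k[Z(G) ⧸ (Z(G) ∩ H)]`. -/
theorem bernsteinMap_app_apply [IsLocallyProfinite G]
    (x : completedGroupAlgebra k (Subgroup.center G)) (V : SmoothRep.{u, v, w} k G) (v : V.obj)
    (H : CompactOpenSubgroup G) (hv : ∀ g ∈ H.1, V.obj.ρ g v = v) :
    ((bernsteinMap k G x).app V).hom.hom v =
      (fixedAction (centerRep V.obj) H.centerInter (x.1 H.centerInter)
        ⟨v, mem_invariants_centerInter H hv⟩ : V.obj) :=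
  completedActionFun_eq V.isCompactOpenFixed x v _ _

end Smooth

end

/-! For an open subgroup `U`, the base coset generates `k[G ⧸ U]`, and maps from it to a smooth `V`
correspond to `U`-fixed vectors of `V`. By naturality an element `z` of the Bernstein center is
therefore determined by the images of the base cosets, the finitely supported functions
`bernsteinCoeff z U` on `G ⧸ U` (`bernsteinCenter_app_apply`). These are compatible under
projection, and invariant under conjugation by elements normalising `U`. For `z` in the image of
`bernsteinMap` they are the components of the completed group algebra, transported along `Z(G) ⧸
(Z(G) ∩ H) ↪ G ⧸ H`; this gives injectivity.

Surjectivity amounts to the coefficients living on cosets that meet the center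
(`exists_center_of_bernsteinCoeff_ne_zero`). Suppose `xU` misses the center, with `U` inside an open
pro-`p` subgroup. The group `P = U ∩ xUx⁻¹` acts on `xU` by conjugation. No point of `xU` has an
open centraliser, so by compactness some small `N` has the property that `P` fixes no coset `yN` in
`xU`. All `P`-orbits on these cosets then have size a positive power of `p`. The coefficient at `xU`
is the sum of the `P`-invariant coefficients at the `yN`, so it vanishes in characteristic `p`. -/

noncomputable section

/-! ### The representations `k[G ⧸ U]` and the coefficients of a central element -/

section CosetRepresentation

/-- The linear map `k[G ⧸ U] → V` sending the coset `gU` to `g • v`, for a `U`-fixed vector `v`. -/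
def cosetLift {k G V : Type*} [Field k] [Group G] [AddCommGroup V] [Module k V]
    (ρ : Representation k G V) (U : Subgroup G) (v : V) (hv : ∀ g ∈ U, ρ g v = v) :
    (G ⧸ U →₀ k) →ₗ[k] V :=
  Finsupp.linearCombination k fun x => Quotient.liftOn' x (fun g => ρ g v) fun a b hab => by
    have h := hv _ (QuotientGroup.leftRel_apply.1 hab)
    rw [map_mul, Module.End.mul_apply] at h
    rw [← Representation.self_inv_apply ρ a (ρ b v), h]

@[simp]
theorem cosetLift_single {k G V : Type*} [Field k] [Group G] [AddCommGroup V] [Module k V]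
    (ρ : Representation k G V) (U : Subgroup G) (v : V) (hv : ∀ g ∈ U, ρ g v = v) (g : G) (r : k) :
    cosetLift ρ U v hv (Finsupp.single (g : G ⧸ U) r) = r • ρ g v :=
  Finsupp.linearCombination_single k r _

variable (k : Type u) {G : Type v} [Field k] [Group G]

/-- The permutation representation of `G` on `k[G ⧸ U]`. -/
def cosetRep (U : Subgroup G) : Representation k G (ULift.{w} (G ⧸ U) →₀ k) where
  toFun g := Finsupp.lmapDomain k k (g • ·)
  map_one' := by ext; simp
  map_mul' g h := by ext; simp [mul_smul]

variable {k}

@[simp]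
theorem cosetRep_single (U : Subgroup G) (g : G) (x : ULift.{w} (G ⧸ U)) (r : k) :
    cosetRep k U g (Finsupp.single x r) = Finsupp.single (g • x) r :=
  Finsupp.mapDomain_single

/-- The computation shared by change of level, conjugation and comparison with the center: a map
between coset representations that sends cosets to cosets is a pushforward of functions. -/
theorem cosetLift_cosetRep (U U' : Subgroup G) (φ : G ⧸ U' → G ⧸ U)
    (v : ULift.{w} (G ⧸ U) →₀ k) (hv : ∀ g ∈ U', cosetRep k U g v = v)
    (h : ∀ g : G, cosetRep k U g v = Finsupp.single (ULift.up (φ g)) 1) (a : G ⧸ U' →₀ k) :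
    Finsupp.mapDomain ULift.down (cosetLift (cosetRep k U) U' v hv a) = Finsupp.mapDomain φ a := by
  induction a using Finsupp.induction_linear with
  | zero => simp
  | add a b ha hb => rw [map_add, Finsupp.mapDomain_add, ha, hb, Finsupp.mapDomain_add]
  | single x r =>
    induction x using QuotientGroup.induction_on with
    | H x => rw [cosetLift_single, h]; simp

variable (k) [TopologicalSpace G] [IsTopologicalGroup G]

/-- The smooth representation `k[G ⧸ U]` of `G`, for an open subgroup `U`. -/
def smoothCosetRep (U : Subgroup G) (hU : IsOpen (U : Set G)) :
    SmoothRep.{u, v, max u v w} k G :=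
  -- The `ULift` places the module in universe `max u v w`, so that it is an object of the category
  -- whose center is studied.
  ⟨Rep.of (cosetRep.{u, v, w} k U), fun (f : ULift.{w} (G ⧸ U) →₀ k) => by
    induction f using Finsupp.induction_linear with
    | zero => exact ⟨⊤, isOpen_univ, fun g _ => map_zero _⟩
    | add a b ha hb =>
      obtain ⟨A, hA, hA'⟩ := ha
      obtain ⟨B, hB, hB'⟩ := hb
      exact ⟨A ⊓ B, hA.inter hB, fun g hg => by
        rw [map_add]; exact congrArg₂ (· + ·) (hA' g hg.1) (hB' g hg.2)⟩
    | single x r =>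
      obtain ⟨x⟩ := x
      induction x using QuotientGroup.induction_on with
      | H x =>
        -- The stabiliser of the coset `xU` is `xUx⁻¹`.
        refine ⟨U.comap (MulAut.conj x⁻¹).toMonoidHom, hU.preimage (f := fun g => x⁻¹ * g * x⁻¹⁻¹)
          (by fun_prop), fun g hg => ?_⟩
        refine (cosetRep_single U g _ r).trans ?_
        congr 1
        refine ULift.ext _ _ (QuotientGroup.eq.2 ?_)
        have : x⁻¹ * g * x ∈ U := by simpa using hg
        simpa [mul_assoc] using inv_mem this⟩

variable {k}

/-- The image of the base point of `k[G ⧸ U]` under an element of the Bernstein center. -/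
def bernsteinCoeff (z : BernsteinCenter.{u, v, max u v w} k G) (U : Subgroup G)
    (hU : IsOpen (U : Set G)) : G ⧸ U →₀ k :=
  Finsupp.mapDomain ULift.down
    ((z.app (smoothCosetRep.{u, v, w} k U hU)).hom.hom
      (Finsupp.single (ULift.up ((1 : G) : G ⧸ U)) (1 : k) : ULift.{w} (G ⧸ U) →₀ k) :
      ULift.{w} (G ⧸ U) →₀ k)

/-- Naturality of `z` along the map `k[G ⧸ U] → V` that sends the base coset to `v`. -/
theorem bernsteinCenter_app_apply (z : BernsteinCenter.{u, v, max u v w} k G)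
    (V : SmoothRep.{u, v, max u v w} k G) (U : Subgroup G) (hU : IsOpen (U : Set G)) (v : V.obj)
    (hv : ∀ g ∈ U, V.obj.ρ g v = v) :
    (z.app V).hom.hom v = cosetLift V.obj.ρ U v hv (bernsteinCoeff z U hU) := by
  let f : smoothCosetRep.{u, v, w} k U hU ⟶ V := ObjectProperty.homMk (Rep.ofHom
    { toLinearMap := cosetLift V.obj.ρ U v hv ∘ₗ Finsupp.lmapDomain k k ULift.down
      isIntertwining' := fun g => by
        ext ⟨x⟩
        induction x using QuotientGroup.induction_on with
        | H x =>
          simp only [LinearMap.comp_apply, Finsupp.lsingle_apply, cosetRep_single,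
            Finsupp.lmapDomain_apply, Finsupp.mapDomain_single, cosetLift_single, one_smul]
          refine (cosetLift_single V.obj.ρ U v hv (g * x) 1).trans ?_
          rw [one_smul, map_mul, Module.End.mul_apply] })
  have h := congrArg (fun φ : smoothCosetRep.{u, v, w} k U hU ⟶ V => φ.hom.hom
    (Finsupp.single (ULift.up ((1 : G) : G ⧸ U)) (1 : k) : ULift.{w} (G ⧸ U) →₀ k))
    (z.naturality f)
  refine Eq.trans ?_ h
  change _ = (z.app V).hom.hom (cosetLift V.obj.ρ U v hv (Finsupp.mapDomain ULift.down _))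
  rw [Finsupp.mapDomain_single, cosetLift_single, map_one, one_smul, Module.End.one_apply]

/-- The base coset of `k[G ⧸ U]` is also a `U'`-fixed vector, so `bernsteinCenter_app_apply`
computes its image from the coefficients at level `U'`. -/
theorem mapDomain_bernsteinCoeff (z : BernsteinCenter.{u, v, max u v w} k G) (U U' : Subgroup G)
    (hU : IsOpen (U : Set G)) (hU' : IsOpen (U' : Set G)) (h : U' ≤ U) :
    Finsupp.mapDomain (Subgroup.quotientMapOfLE h) (bernsteinCoeff z U' hU') =
      bernsteinCoeff z U hU := by
  have hs : ∀ g : G, cosetRep k U g (Finsupp.single (ULift.up ((1 : G) : G ⧸ U)) (1 : k)) =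
      Finsupp.single (ULift.up.{w} (Subgroup.quotientMapOfLE h (g : G ⧸ U'))) 1 := fun g => by
    rw [cosetRep_single]
    exact congrArg (fun x : G => Finsupp.single (ULift.up.{w} (x : G ⧸ U)) (1 : k)) (mul_one g)
  have hv : ∀ g ∈ U', cosetRep k U g (Finsupp.single (ULift.up.{w} ((1 : G) : G ⧸ U)) (1 : k)) =
      Finsupp.single (ULift.up ((1 : G) : G ⧸ U)) 1 := fun g hg => by
    rw [hs]
    exact congrArg (fun x => Finsupp.single (ULift.up.{w} x) (1 : k))
      (QuotientGroup.eq.2 (by simpa using h hg))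
  exact ((congrArg (Finsupp.mapDomain ULift.down) (bernsteinCenter_app_apply z
    (smoothCosetRep.{u, v, w} k U hU) U' hU' _ hv)).trans
      (cosetLift_cosetRep U U' _ _ hv hs _)).symm

/-- The image of the coset `uU` under `z` can be computed twice. Since `u` normalises `U`,
naturality makes it the right translate by `u` of the image of the base coset; equivariance makes it
the left translate. Comparing coefficients at `ugU` gives the claim. -/
theorem bernsteinCoeff_conj (z : BernsteinCenter.{u, v, max u v w} k G) (U : Subgroup G)
    (hU : IsOpen (U : Set G)) (u : G) (hu : ∀ n ∈ U, u⁻¹ * n * u ∈ U)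
    (hu' : ∀ n ∈ U, u * n * u⁻¹ ∈ U) (g : G) :
    bernsteinCoeff z U hU ((u * g * u⁻¹ : G) : G ⧸ U) = bernsteinCoeff z U hU (g : G ⧸ U) := by
  let φ : G ⧸ U → G ⧸ U := Quotient.map' (fun x => x * u) fun a b hab => by
    rw [QuotientGroup.leftRel_apply] at hab ⊢
    simpa [mul_assoc] using hu _ hab
  have hφ : Function.Injective φ := fun a b => by
    induction a using QuotientGroup.induction_on with | H a => ?_
    induction b using QuotientGroup.induction_on with | H b => ?_
    intro h
    have h' : (a * u)⁻¹ * (b * u) ∈ U := QuotientGroup.eq.1 h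
    refine QuotientGroup.eq.2 ?_
    have := hu' _ h'
    simpa [mul_assoc] using this
  have hs : ∀ g : G, cosetRep k U g (Finsupp.single (ULift.up (u : G ⧸ U)) (1 : k)) =
      Finsupp.single (ULift.up.{w} (φ (g : G ⧸ U))) 1 := fun g => cosetRep_single U g _ 1
  have hv : ∀ g ∈ U, cosetRep k U g (Finsupp.single (ULift.up.{w} (u : G ⧸ U)) (1 : k)) =
      Finsupp.single (ULift.up (u : G ⧸ U)) 1 := fun g hg => by
    rw [hs]
    refine congrArg (fun x => Finsupp.single (ULift.up.{w} x) (1 : k)) (QuotientGroup.eq.2 ?_)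
    simpa [mul_assoc] using hu _ (inv_mem hg)
  have key : Finsupp.mapDomain φ (bernsteinCoeff z U hU) =
      Finsupp.mapDomain (u • ·) (bernsteinCoeff z U hU) := by
    rw [← cosetLift_cosetRep U U φ _ hv hs]
    have h1 := bernsteinCenter_app_apply z (smoothCosetRep.{u, v, w} k U hU) U hU _ hv
    have h2 := Rep.hom_comm_apply (z.app (smoothCosetRep.{u, v, w} k U hU)).hom u
      (Finsupp.single (ULift.up ((1 : G) : G ⧸ U)) (1 : k) : ULift.{w} (G ⧸ U) →₀ k)
    have h3 : cosetRep k U u (Finsupp.single (ULift.up.{w} ((1 : G) : G ⧸ U)) (1 : k)) =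
        Finsupp.single (ULift.up (u : G ⧸ U)) 1 := by
      rw [cosetRep_single]
      exact congrArg (fun x : G => Finsupp.single (ULift.up.{w} (x : G ⧸ U)) (1 : k)) (mul_one u)
    refine (congrArg (Finsupp.mapDomain ULift.down)
      (h1.symm.trans (((congrArg _ h3).symm.trans h2)))).trans ?_
    have hdown : ∀ b : ULift.{w} (G ⧸ U) →₀ k,
        Finsupp.mapDomain ULift.down (Finsupp.mapDomain (u • ·) b) =
          Finsupp.mapDomain (u • ·) (Finsupp.mapDomain ULift.down b) := fun b => by
      rw [← Finsupp.mapDomain_comp, ← Finsupp.mapDomain_comp]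
      rfl
    exact hdown _
  have e1 := Finsupp.mapDomain_apply hφ (bernsteinCoeff z U hU) ((u * g * u⁻¹ : G) : G ⧸ U)
  have e2 := Finsupp.mapDomain_apply (MulAction.injective u) (bernsteinCoeff z U hU) (g : G ⧸ U)
  rw [← e1, ← e2, key]
  congr 1
  exact congrArg (fun x : G => (x : G ⧸ U)) (inv_mul_cancel_right (u * g) u)

end CosetRepresentation

/-! ### The action of the completed group algebra in terms of cosets -/

section CenterCoset

variable {k : Type u} {G : Type v} [Field k] [Group G] [TopologicalSpace G] [IsLocallyProfinite G]

/-- The embedding of `Z(G) ⧸ (Z(G) ∩ H)` into `G ⧸ H`. -/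
def centerCosetMap (H : CompactOpenSubgroup G) :
    Subgroup.center G ⧸ H.centerInter.1 → G ⧸ H.1 :=
  Quotient.map' Subtype.val fun a b hab => by
    rw [QuotientGroup.leftRel_apply] at hab ⊢
    exact hab

theorem centerCosetMap_injective (H : CompactOpenSubgroup G) :
    Function.Injective (centerCosetMap H) := fun a b => by
  induction a using QuotientGroup.induction_on with | H a => ?_
  induction b using QuotientGroup.induction_on with | H b => ?_
  exact fun h => QuotientGroup.eq.2 (QuotientGroup.eq.1 h : (a : G)⁻¹ * b ∈ H.1)

theorem fixedAction_eq_cosetLift (V : Rep.{w} k G)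
    (H : CompactOpenSubgroup G) (v : V) (hv : ∀ g ∈ H.1, V.ρ g v = v)
    (a : MonoidAlgebra k (Subgroup.center G ⧸ H.centerInter.1)) :
    (fixedAction (centerRep V) H.centerInter a ⟨v, mem_invariants_centerInter H hv⟩ : V) =
      cosetLift V.ρ H.1 v hv (Finsupp.mapDomain (centerCosetMap H) a.coeff) := by
  induction a using MonoidAlgebra.induction_linear with
  | zero => simp
  | add a b ha hb =>
    simp only [map_add, LinearMap.add_apply, Submodule.coe_add, ha, hb, MonoidAlgebra.coeff_add,
      Finsupp.mapDomain_add]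
  | single g r =>
    induction g using QuotientGroup.induction_on with
    | H z =>
      rw [MonoidAlgebra.coeff_single, Finsupp.mapDomain_single]
      refine Eq.trans ?_ (cosetLift_single V.ρ H.1 v hv z r).symm
      simp only [fixedAction, Representation.asAlgebraHom_single, LinearMap.smul_apply,
        Submodule.coe_smul]
      rfl

theorem bernsteinMap_app_apply_eq_cosetLift
    (x : completedGroupAlgebra k (Subgroup.center G)) (V : SmoothRep.{u, v, w} k G) (v : V.obj)
    (H : CompactOpenSubgroup G) (hv : ∀ g ∈ H.1, V.obj.ρ g v = v) :
    ((bernsteinMap k G x).app V).hom.hom v =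
      cosetLift V.obj.ρ H.1 v hv
        (Finsupp.mapDomain (centerCosetMap H) (x.1 H.centerInter).coeff) :=
  (bernsteinMap_app_apply k G x V v H hv).trans (fixedAction_eq_cosetLift V.obj H v hv _)

/-- The components of `x` at the subgroups `Z(G) ∩ H` can be recovered from its action on `k[G ⧸
H]`, which is what injectivity needs. -/
theorem bernsteinCoeff_bernsteinMap (x : completedGroupAlgebra k (Subgroup.center G))
    (H : CompactOpenSubgroup G) :
    bernsteinCoeff.{u, v, w} (bernsteinMap k G x) H.1 H.2.1 =
      Finsupp.mapDomain (centerCosetMap H) (x.1 H.centerInter).coeff := by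
  have hs : ∀ g : G, cosetRep k H.1 g (Finsupp.single (ULift.up ((1 : G) : G ⧸ H.1)) (1 : k)) =
      Finsupp.single (ULift.up.{w} (id (g : G ⧸ H.1))) 1 := fun g => by
    rw [cosetRep_single]
    exact congrArg (fun x : G => Finsupp.single (ULift.up.{w} (x : G ⧸ H.1)) (1 : k)) (mul_one g)
  have hv : ∀ g ∈ H.1, cosetRep k H.1 g
      (Finsupp.single (ULift.up.{w} ((1 : G) : G ⧸ H.1)) (1 : k)) =
      Finsupp.single (ULift.up ((1 : G) : G ⧸ H.1)) 1 := fun g hg => by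
    rw [hs]
    exact congrArg (fun x => Finsupp.single (ULift.up.{w} x) (1 : k))
      (QuotientGroup.eq.2 (by simpa using hg))
  exact ((congrArg (Finsupp.mapDomain ULift.down) (bernsteinMap_app_apply_eq_cosetLift x
    (smoothCosetRep.{u, v, w} k H.1 H.2.1) _ H hv)).trans
      (cosetLift_cosetRep H.1 H.1 _ _ hv hs _)).trans Finsupp.mapDomain_id

end CenterCoset

/-! ### The coefficients are supported on cosets meeting the center -/

section Support

/-- A finitely supported function on a set with a group action which is invariant under the group
has sum zero in characteristic `p` if the stabilizers of all points of its support have index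
divisible by `p`. -/
theorem Finsupp.sum_eq_zero_of_dvd_index_stabilizer {P β k : Type*} [Group P] [MulAction P β]
    [Field k] (p : ℕ) [CharP k p] (f : β →₀ k) (hf : ∀ (u : P) (b : β), f (u • b) = f b)
    (hp : ∀ b, f b ≠ 0 → p ∣ (MulAction.stabilizer P b).index) :
    (f.sum fun _ r => r) = 0 := by
  classical
  let S : SubMulAction P β := ⟨f.support, fun c x hx => by simpa [hf] using hx⟩
  have : Fintype S := inferInstanceAs (Fintype f.support)
  have h1 : (f.sum fun _ r => r) = ∑ b : S, f b :=
    Finset.sum_subtype f.support (p := (· ∈ S)) (fun _ => Iff.rfl) f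
  have : Fintype (Quotient (MulAction.orbitRel P S)) := Fintype.ofFinite _
  have (ω : Quotient (MulAction.orbitRel P S)) : Fintype (MulAction.orbit P ω.out) :=
    Fintype.ofFinite _
  rw [h1, ← (MulAction.selfEquivSigmaOrbits P S).symm.sum_comp, Fintype.sum_sigma]
  -- On each orbit `f` is constant, and the size of the orbit is the index of a stabiliser, hence
  -- zero in `k`.
  refine Finset.sum_eq_zero fun ω _ => ?_
  have hc : ∀ b : MulAction.orbit P ω.out,
      f ((MulAction.selfEquivSigmaOrbits P S).symm ⟨ω, b⟩) = f ω.out := by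
    rintro ⟨_, u, rfl⟩
    exact hf u _
  rw [Finset.sum_congr rfl fun b _ => hc b, Finset.sum_const, Finset.card_univ, nsmul_eq_mul]
  have h2 := hp ω.out (Finsupp.mem_support_iff.1 ω.out.2)
  rw [← SubMulAction.stabilizer_of_subMul, MulAction.index_stabilizer, Set.ncard_eq_toFinset_card',
    Set.toFinset_card] at h2
  rw [(CharP.cast_eq_zero_iff k p _).2 h2, zero_mul]

/-- An open subgroup contains an open normal one, whose index is a power of `p` divisible by that of
`V`. -/
theorem IsProP.index_eq_pow {p : ℕ} [Fact p.Prime] {H : Type*} [Group H] [TopologicalSpace H]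
    (h : IsProP p H) (V : Subgroup H) (hV : IsOpen (V : Set H)) : ∃ n : ℕ, V.index = p ^ n := by
  have := h.toIsTopologicalGroup
  have := h.toCompactSpace
  obtain ⟨N, hN⟩ := IsTopologicalGroup.exist_openNormalSubgroup_sub_clopen_nhds_of_one
    ⟨V.isClosed_of_isOpen hV, hV⟩ V.one_mem
  obtain ⟨n, hn⟩ := h.index_eq N.toSubgroup inferInstance N.isOpen'
  obtain ⟨m, -, hm⟩ := (Nat.dvd_prime_pow Fact.out).1 (hn ▸ Subgroup.index_dvd_of_le hN)
  exact ⟨m, hm⟩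

/-- Every open subgroup of an open subgroup of a pro-`p` group has index a power of `p`. -/
theorem IsProP.index_eq_pow_of_le {p : ℕ} [Fact p.Prime] {G : Type*} [Group G] [TopologicalSpace G]
    [IsTopologicalGroup G] {U : Subgroup G} (h : IsProP p U) (W : Subgroup G) (hWU : W ≤ U)
    (hW : IsOpen (W : Set G)) (V : Subgroup W) (hV : IsOpen (V : Set W)) :
    ∃ n : ℕ, V.index = p ^ n := by
  have hV' : IsOpen (V.map W.subtype : Set G) := hW.isOpenMap_subtype_val _ hV
  obtain ⟨n, hn⟩ := h.index_eq_pow ((V.map W.subtype).subgroupOf U)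
    (hV'.preimage continuous_subtype_val)
  have hle : V.map W.subtype ≤ W := Subgroup.map_subtype_le V
  have h1 : (V.map W.subtype).relIndex W = V.index := by
    rw [Subgroup.relIndex, Subgroup.subgroupOf, Subgroup.comap_map_eq_self_of_injective
      W.subtype_injective]
  have h2 := Subgroup.relIndex_mul_relIndex _ _ _ hle hWU
  obtain ⟨m, -, hm⟩ := (Nat.dvd_prime_pow Fact.out).1
    (⟨_, (h1 ▸ h2.trans hn : V.index * W.relIndex U = p ^ n).symm⟩ : V.index ∣ p ^ n)
  exact ⟨m, hm⟩

/-- The open subgroups normalised by an open profinite subgroup form a neighbourhood basis. -/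
theorem exists_open_subgroup_normalised {G : Type*} [Group G] [TopologicalSpace G]
    [IsTopologicalGroup G] (U : Subgroup G) [CompactSpace U] [TotallyDisconnectedSpace U]
    (hU : IsOpen (U : Set G)) (W : Set G) (hW : IsOpen W) (h1 : 1 ∈ W) :
    ∃ N : Subgroup G, IsOpen (N : Set G) ∧ (N : Set G) ⊆ W ∧
      ∀ u ∈ U, ∀ n ∈ N, u * n * u⁻¹ ∈ N := by
  obtain ⟨N, hN⟩ := ProfiniteGrp.exist_openNormalSubgroup_sub_open_nhds_of_one (G := U)
    (hW.preimage continuous_subtype_val) h1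
  refine ⟨N.toSubgroup.map U.subtype, hU.isOpenMap_subtype_val _ N.isOpen', ?_, ?_⟩
  · rintro _ ⟨n, hn, rfl⟩
    exact hN hn
  · rintro u hu _ ⟨n, hn, rfl⟩
    exact ⟨⟨u, hu⟩ * n * ⟨u, hu⟩⁻¹, N.isNormal'.conj_mem n hn _, rfl⟩

/-- If the compact set `C` does not meet the center, then an open subgroup `P` moves by
conjugation every coset `yN` with `y ∈ C`, for some open subgroup `N` normalised by `U`. -/
theorem exists_open_subgroup_forall_conj_ne {G : Type*} [Group G] [TopologicalSpace G]
    [IsTopologicalGroup G] [T1Space G] (hc : NoProperOpenCentralisers G) (U : Subgroup G)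
    [CompactSpace U] [TotallyDisconnectedSpace U]
    (hU : IsOpen (U : Set G)) (P : Subgroup G) (hP : IsOpen (P : Set G)) (hPU : P ≤ U) (C : Set G)
    (hC : IsCompact C) (hZ : ∀ y ∈ C, y ∉ Subgroup.center G) :
    ∃ N : Subgroup G, IsOpen (N : Set G) ∧ (∀ u ∈ U, ∀ n ∈ N, u * n * u⁻¹ ∈ N) ∧
      ∀ y ∈ C, ∃ u ∈ P, y⁻¹ * (u * y * u⁻¹) ∉ N := by
  refine hC.induction_on ⟨⊤, isOpen_univ, by simp, by simp⟩ ?_ ?_ ?_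
  · rintro s t hst ⟨N, h1, h2, h3⟩
    exact ⟨N, h1, h2, fun y hy => h3 y (hst hy)⟩
  · rintro s t ⟨N, h1, h2, h3⟩ ⟨M, h1', h2', h3'⟩
    refine ⟨N ⊓ M, h1.inter h1', fun u hu n hn => ⟨h2 u hu n hn.1, h2' u hu n hn.2⟩, ?_⟩
    rintro y (hy | hy)
    · obtain ⟨u, hu, h⟩ := h3 y hy
      exact ⟨u, hu, fun h' => h h'.1⟩
    · obtain ⟨u, hu, h⟩ := h3' y hy
      exact ⟨u, hu, fun h' => h h'.2⟩
  · intro y hy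
    obtain ⟨u, hu, huy⟩ : ∃ u ∈ P, u * y ≠ y * u := by
      by_contra! hcon
      have hle : P ≤ Subgroup.centralizer {y} := fun u hu =>
        Subgroup.mem_centralizer_singleton_iff.2 (hcon u hu)
      have htop := hc y (Subgroup.isOpen_mono hle hP)
      refine hZ y hy (Subgroup.mem_center_iff.2 fun g => ?_)
      exact Subgroup.mem_centralizer_singleton_iff.1 (htop ▸ Subgroup.mem_top g)
    -- Choose `N` to avoid the nontrivial commutator `y⁻¹uyu⁻¹`; the same `u` and `N` then work on
    -- the whole neighbourhood `yN`.
    obtain ⟨N, hN, hNW, hNU⟩ := exists_open_subgroup_normalised U hU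
      {y⁻¹ * (u * y * u⁻¹)}ᶜ isOpen_compl_singleton (fun h => huy (by
        rw [Set.mem_singleton_iff, eq_comm, inv_mul_eq_one, eq_mul_inv_iff_mul_eq] at h
        exact h.symm))
    refine ⟨(fun g => y⁻¹ * g) ⁻¹' N, mem_nhdsWithin_of_mem_nhds
      ((hN.preimage (by fun_prop)).mem_nhds (by simp)), N, hN, hNU, fun x hx => ⟨u, hu, fun h => ?_⟩⟩
    have hx' : y⁻¹ * x ∈ N := hx
    -- With `n = y⁻¹x`, one has `y⁻¹uyu⁻¹ = n · (x⁻¹uxu⁻¹) · (un⁻¹u⁻¹)`, a product of elements of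
    -- `N`.
    have h1 := N.mul_mem (N.mul_mem hx' h) (hNU u (hPU hu) _ (N.inv_mem hx'))
    exact hNW h1 (by simp only [Set.mem_singleton_iff]; group)

variable {k : Type u} {G : Type v} [Field k] [Group G] [TopologicalSpace G] [IsTopologicalGroup G]

/-- Conjugation by elements of `P` on the cosets of a subgroup normalised by `P`. -/
@[reducible]
def conjCosetAction (P N : Subgroup G) (h : ∀ u ∈ P, ∀ n ∈ N, u * n * u⁻¹ ∈ N) :
    MulAction P (G ⧸ N) where
  smul u := Quotient.map' (fun g => u * g * (u : G)⁻¹) fun a b hab => by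
    rw [QuotientGroup.leftRel_apply] at hab ⊢
    simpa [mul_assoc] using h u u.2 _ hab
  one_smul x := by
    induction x using QuotientGroup.induction_on with
    | H x => exact congrArg (fun g : G => (g : G ⧸ N)) (by simp)
  mul_smul a b x := by
    induction x using QuotientGroup.induction_on with
    | H x => exact congrArg (fun g : G => (g : G ⧸ N)) (by simp [mul_assoc])

/-- In the absence of proper open centralisers, `z` maps the base point of `k[G ⧸ U]` to a linear
combination of cosets which meet the center. -/
theorem exists_center_of_bernsteinCoeff_ne_zero (p : ℕ) [Fact p.Prime] [CharP k p] [T1Space G]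
    (hc : NoProperOpenCentralisers G) (U₀ : Subgroup G) (hU₀ : IsOpen (U₀ : Set G))
    (hp : IsProP p U₀) (z : BernsteinCenter.{u, v, max u v w} k G) (U : Subgroup G)
    (hU : IsOpen (U : Set G)) (hUU₀ : U ≤ U₀) (x : G)
    (hx : bernsteinCoeff z U hU (x : G ⧸ U) ≠ 0) :
    ∃ y : Subgroup.center G, ((y : G) : G ⧸ U) = x := by
  by_contra! hcon
  refine hx ?_
  have := hp.toCompactSpace
  have := hp.toTotallyDisconnectedSpace
  have hUc : IsCompact (U : Set G) :=
    (isCompact_iff_compactSpace.2 ‹CompactSpace U₀›).of_isClosed_subset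
      (U.isClosed_of_isOpen hU) hUU₀
  -- This is `U ∩ xUx⁻¹`, chosen so that conjugation by `P` preserves the coset `xU`.
  let P : Subgroup G := U ⊓ U.comap (MulAut.conj x⁻¹).toMonoidHom
  have hPx : ∀ u ∈ P, x⁻¹ * u * x ∈ U := fun u hu => by simpa using hu.2
  have hP : IsOpen (P : Set G) :=
    hU.inter (hU.preimage (f := fun g => x⁻¹ * g * x⁻¹⁻¹) (by fun_prop))
  have hPU : P ≤ U := inf_le_left
  obtain ⟨M, hM, -, hMP⟩ := exists_open_subgroup_forall_conj_ne hc U₀ hU₀ P hP (hPU.trans hUU₀)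
    ((fun g => x * g) '' U) (hUc.image (by fun_prop)) (by
      rintro _ ⟨g, hg, rfl⟩ hz
      exact hcon ⟨_, hz⟩ (QuotientGroup.eq.2 (by simpa using inv_mem hg)))
  obtain ⟨N, hN, hNM, hNU₀⟩ := exists_open_subgroup_normalised U₀ hU₀ (M ⊓ U : Subgroup G)
    (hM.inter hU) (one_mem _)
  have hNU : N ≤ U := fun n hn => (hNM hn).2
  have hNP : ∀ u ∈ P, ∀ n ∈ N, u * n * u⁻¹ ∈ N := fun u hu => hNU₀ u (hUU₀ (hPU hu))
  let := conjCosetAction P N hNP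
  classical
  -- The coefficients at level `N` on the cosets `yN` contained in `xU`; they add up to the
  -- coefficient of `xU` at level `U`.
  let f := (bernsteinCoeff z N hN).filter fun y => Subgroup.quotientMapOfLE hNU y = (x : G ⧸ U)
  have hsum : bernsteinCoeff z U hU (x : G ⧸ U) = f.sum fun _ r => r := by
    rw [← mapDomain_bernsteinCoeff z U N hU hN hNU, Finsupp.mapDomain, Finsupp.sum_apply,
      Finsupp.sum_filter_index, Finsupp.sum, Finsupp.support_filter,
      Finset.sum_filter]
    exact Finset.sum_congr rfl fun y _ => Finsupp.single_apply
  rw [hsum]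
  have hfib : ∀ (u : P) (y : G), (((u * y * (u : G)⁻¹ : G) : G ⧸ U) = x ↔ (y : G ⧸ U) = x) := by
    intro u y
    rw [eq_comm, QuotientGroup.eq, eq_comm, QuotientGroup.eq]
    have e : x⁻¹ * (u * y * (u : G)⁻¹) = (x⁻¹ * u * x) * (x⁻¹ * y) * (u : G)⁻¹ := by group
    rw [e, U.mul_mem_cancel_right (inv_mem (hPU u.2)), U.mul_mem_cancel_left (hPx u u.2)]
  refine f.sum_eq_zero_of_dvd_index_stabilizer (P := P) p ?_ ?_
  · intro u y
    induction y using QuotientGroup.induction_on with | H y => ?_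
    have h1 := bernsteinCoeff_conj z N hN u
      (fun n hn => by simpa using hNP _ (inv_mem u.2) n hn) (hNP _ u.2) y
    simp only [f, Finsupp.filter_apply]
    exact if_congr (hfib u y) h1 rfl
  · intro y hy
    induction y using QuotientGroup.induction_on with | H y => ?_
    have hy' : (y : G ⧸ U) = x := by
      by_contra h
      exact hy (Finsupp.filter_apply_neg _ _ h)
    have hst : ∀ u : P, u ∈ MulAction.stabilizer P (y : G ⧸ N) ↔ y⁻¹ * (u * y * (u : G)⁻¹) ∈ N :=
      fun u => by
        rw [MulAction.mem_stabilizer_iff, eq_comm]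
        exact QuotientGroup.eq
    have hopen : IsOpen (MulAction.stabilizer P (y : G ⧸ N) : Set P) := by
      have : (MulAction.stabilizer P (y : G ⧸ N) : Set P) =
          (fun u : P => y⁻¹ * (u * y * (u : G)⁻¹)) ⁻¹' N := Set.ext hst
      rw [this]
      exact hN.preimage (by fun_prop)
    obtain ⟨n, hn⟩ := hp.index_eq_pow_of_le P (hPU.trans hUU₀) hP _ hopen
    rw [hn]
    refine dvd_pow_self p ?_
    -- Exponent zero would mean that `P` fixes `yN`, against the choice of `M`, which contains `N`.
    rintro rfl
    rw [pow_zero, Subgroup.index_eq_one] at hn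
    obtain ⟨u, hu, huN⟩ := hMP y ⟨x⁻¹ * y, QuotientGroup.eq.1 hy'.symm, by simp⟩
    exact huN (hNM ((hst ⟨u, hu⟩).1 (hn ▸ Subgroup.mem_top _))).1

end Support

/-! ### Assembling an element of the completed group algebra -/

section CompletedGroupAlgebra

theorem MonoidAlgebra.mapDomain_quotientMap_mapDomain {k Z : Type*} [Field k] [Group Z]
    (K L M : Subgroup Z) [K.Normal] [L.Normal] [M.Normal] (hKL : K ≤ L) (hLM : L ≤ M)
    (a : MonoidAlgebra k (Z ⧸ K)) :
    MonoidAlgebra.mapDomain (QuotientGroup.map L M (MonoidHom.id Z) hLM)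
        (MonoidAlgebra.mapDomain (QuotientGroup.map K L (MonoidHom.id Z) hKL) a) =
      MonoidAlgebra.mapDomain (QuotientGroup.map K M (MonoidHom.id Z) (hKL.trans hLM)) a := by
  induction a using MonoidAlgebra.induction_linear with
  | zero => simp
  | add a b ha hb => simp only [MonoidAlgebra.mapDomain_add, ha, hb]
  | single g r =>
    induction g using QuotientGroup.induction_on with
    | H g => simp only [MonoidAlgebra.mapDomain_single]; rfl

variable {k : Type u} {G : Type v} [Field k] [Group G] [TopologicalSpace G] [IsLocallyProfinite G]

/-- The intersections of the center with small compact open subgroups of `G` are cofinal among the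
compact open subgroups of the center. -/
theorem exists_centerInter_le (U : Subgroup G) (hU : IsOpen (U : Set G))
    (K : CompactOpenSubgroup (Subgroup.center G)) :
    ∃ H : CompactOpenSubgroup G, H.1 ≤ U ∧ H.centerInter.1 ≤ K.1 := by
  obtain ⟨W, hW, hWK⟩ := isOpen_induced_iff.1 K.2.1
  have h1 : (1 : G) ∈ W := (Set.ext_iff.1 hWK 1).2 (one_mem K.1)
  -- `H₀` serves only as an open profinite subgroup, for `exists_open_subgroup_normalised`; its
  -- position relative to `U` plays no role.
  obtain ⟨H₀, -⟩ := IsLocallyProfinite.exists_compactOpenSubgroup_le U hU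
  have := isCompact_iff_compactSpace.1 H₀.2.2
  have : TotallyDisconnectedSpace H₀.1 := inferInstance
  obtain ⟨N, hN, hNW, -⟩ := exists_open_subgroup_normalised H₀.1 H₀.2.1 W hW h1
  obtain ⟨H, hH⟩ := IsLocallyProfinite.exists_compactOpenSubgroup_le (N ⊓ U) (hN.inter hU)
  exact ⟨H, hH.trans inf_le_right, fun z hz => (Set.ext_iff.1 hWK z).1 (hNW (hH hz).1)⟩

theorem bernsteinMap_injective :
    Function.Injective (bernsteinMap k G :
      completedGroupAlgebra k (Subgroup.center G) →ₐ[k] BernsteinCenter.{u, v, max u v w} k G) := by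
  intro x y hxy
  refine Subtype.ext (funext fun K => ?_)
  obtain ⟨H, -, hH⟩ := exists_centerInter_le ⊤ isOpen_univ K
  rw [← x.2 H.centerInter K hH, ← y.2 H.centerInter K hH]
  congr 1
  refine MonoidAlgebra.coeff_injective
    (Finsupp.mapDomain_injective (centerCosetMap_injective H) ?_)
  rw [← bernsteinCoeff_bernsteinMap.{u, v, w}, ← bernsteinCoeff_bernsteinMap.{u, v, w}, hxy]

variable (z : BernsteinCenter.{u, v, max u v w} k G)

/-- The element of `k[Z(G) ⧸ (Z(G) ∩ H)]` read off from the action of `z` on `k[G ⧸ H]`. -/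
def centerCoeff (H : CompactOpenSubgroup G) :
    MonoidAlgebra k (Subgroup.center G ⧸ H.centerInter.1) :=
  .ofCoeff ((bernsteinCoeff z H.1 H.2.1).comapDomain (centerCosetMap H)
    (centerCosetMap_injective H).injOn)

variable {z} {U : Subgroup G}

/-- By `hz`, restricting the coefficients to cosets of central elements loses nothing. -/
theorem mapDomain_centerCoeff
    (hz : ∀ (H : CompactOpenSubgroup G), H.1 ≤ U → ∀ x : G,
      bernsteinCoeff z H.1 H.2.1 (x : G ⧸ H.1) ≠ 0 →
        ∃ y : Subgroup.center G, ((y : G) : G ⧸ H.1) = x)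
    (H : CompactOpenSubgroup G) (hH : H.1 ≤ U) :
    Finsupp.mapDomain (centerCosetMap H) (centerCoeff z H).coeff =
      bernsteinCoeff z H.1 H.2.1 := by
  refine Finsupp.mapDomain_comapDomain _ (centerCosetMap_injective H) _ fun x hx => ?_
  induction x using QuotientGroup.induction_on with
  | H x =>
    obtain ⟨y, hy⟩ := hz H hH x (Finsupp.mem_support_iff.1 hx)
    exact ⟨(y : Subgroup.center G ⧸ H.centerInter.1), hy⟩

/-- The identity can be checked after embedding into functions on `G ⧸ H`, where it becomes
`mapDomain_bernsteinCoeff`. -/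
theorem map_centerCoeff
    (hz : ∀ (H : CompactOpenSubgroup G), H.1 ≤ U → ∀ x : G,
      bernsteinCoeff z H.1 H.2.1 (x : G ⧸ H.1) ≠ 0 →
        ∃ y : Subgroup.center G, ((y : G) : G ⧸ H.1) = x)
    (H H' : CompactOpenSubgroup G) (hH : H.1 ≤ U) (h : H'.1 ≤ H.1) :
    MonoidAlgebra.mapDomain (QuotientGroup.map H'.centerInter.1 H.centerInter.1 (MonoidHom.id _)
      fun _ hg => h hg) (centerCoeff z H') = centerCoeff z H := by
  refine MonoidAlgebra.coeff_injective
    (Finsupp.mapDomain_injective (centerCosetMap_injective H) ?_)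
  rw [mapDomain_centerCoeff hz H hH, ← mapDomain_bernsteinCoeff z H.1 H'.1 H.2.1 H'.2.1 h,
    ← mapDomain_centerCoeff hz H' (h.trans hH), ← Finsupp.mapDomain_comp]
  refine (Finsupp.mapDomain_comp (v := (centerCoeff z H').coeff)).symm.trans ?_
  congr 1
  ext x
  induction x using QuotientGroup.induction_on with
  | H x => rfl

/-- Both sides come from level `H ∩ H'`. This independence makes the family built in
`exists_bernsteinMap_eq` compatible. -/
theorem map_centerCoeff_eq
    (hz : ∀ (H : CompactOpenSubgroup G), H.1 ≤ U → ∀ x : G,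
      bernsteinCoeff z H.1 H.2.1 (x : G ⧸ H.1) ≠ 0 →
        ∃ y : Subgroup.center G, ((y : G) : G ⧸ H.1) = x)
    (K : CompactOpenSubgroup (Subgroup.center G)) (H H' : CompactOpenSubgroup G) (hH : H.1 ≤ U)
    (hH' : H'.1 ≤ U) (h : H.centerInter.1 ≤ K.1) (h' : H'.centerInter.1 ≤ K.1) :
    MonoidAlgebra.mapDomain (QuotientGroup.map H.centerInter.1 K.1 (MonoidHom.id _) h)
        (centerCoeff z H) =
      MonoidAlgebra.mapDomain (QuotientGroup.map H'.centerInter.1 K.1 (MonoidHom.id _) h')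
        (centerCoeff z H') := by
  let M : CompactOpenSubgroup G :=
    ⟨H.1 ⊓ H'.1, H.2.1.inter H'.2.1, H.2.2.inter_right (H'.1.isClosed_of_isOpen H'.2.1)⟩
  rw [← map_centerCoeff hz H M hH inf_le_left, ← map_centerCoeff hz H' M hH' inf_le_right]
  exact (MonoidAlgebra.mapDomain_quotientMap_mapDomain _ _ _ _ h _).trans
    (MonoidAlgebra.mapDomain_quotientMap_mapDomain _ _ _ _ h' _).symm

theorem exists_bernsteinMap_eq (hU : IsOpen (U : Set G))
    (hz : ∀ (H : CompactOpenSubgroup G), H.1 ≤ U → ∀ x : G,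
      bernsteinCoeff z H.1 H.2.1 (x : G ⧸ H.1) ≠ 0 →
        ∃ y : Subgroup.center G, ((y : G) : G ⧸ H.1) = x) :
    ∃ x, bernsteinMap k G x = z := by
  -- A compact open `K` in the center need not have the form `Z(G) ∩ H`, so its component is pushed
  -- forward from some smaller `Z(G) ∩ H`.
  choose H hHU hHK using exists_centerInter_le U hU
  let x : completedGroupAlgebra k (Subgroup.center G) :=
    ⟨fun K => MonoidAlgebra.mapDomain
      (QuotientGroup.map (H K).centerInter.1 K.1 (MonoidHom.id _) (hHK K)) (centerCoeff z (H K)),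
      fun K L h => (MonoidAlgebra.mapDomain_quotientMap_mapDomain _ _ _ (hHK K) h _).trans
        (map_centerCoeff_eq hz L (H K) (H L) (hHU K) (hHU L) ((hHK K).trans h) (hHK L))⟩
  have hx : ∀ M : CompactOpenSubgroup G, M.1 ≤ U → x.1 M.centerInter = centerCoeff z M :=
    fun M hM => (map_centerCoeff_eq hz M.centerInter _ M (hHU _) hM (hHK _) le_rfl).trans
      (map_centerCoeff hz M M hM le_rfl)
  refine ⟨x, ?_⟩
  ext V v
  obtain ⟨W, hW, hv⟩ := V.property v
  obtain ⟨M, hM⟩ := IsLocallyProfinite.exists_compactOpenSubgroup_le (W ⊓ U) (hW.inter hU)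
  have hMv : ∀ g ∈ M.1, V.obj.ρ g v = v := fun g hg => hv g (hM hg).1
  have hMU : M.1 ≤ U := hM.trans inf_le_right
  have h1 := bernsteinMap_app_apply_eq_cosetLift x V v M hMv
  rw [hx M hMU, mapDomain_centerCoeff hz M hMU] at h1
  exact h1.trans (bernsteinCenter_app_apply z V M.1 M.2.1 v hMv).symm

end CompletedGroupAlgebra

end

theorem theorem1 (p : ℕ) [Fact p.Prime] (k : Type u) [Field k] [CharP k p]
    (G : Type v) [Group G] [TopologicalSpace G] [IsLocallyProfinite G]
    (hp : IsLocallyProP p G) (hc : NoProperOpenCentralisers G) :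
    Function.Bijective
      (bernsteinMap k G :
        completedGroupAlgebra k (Subgroup.center G) →ₐ[k]
          BernsteinCenter.{u, v, max u v w} k G) := by
  obtain ⟨U, hU, hUp⟩ := hp
  exact ⟨bernsteinMap_injective, fun z => exists_bernsteinMap_eq hU fun H hH =>
    exists_center_of_bernsteinCoeff_ne_zero p hc U hU hUp z H.1 H.2.1 hH⟩
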